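/- Let $\mathrm S_1$ be the set of pure single-qubit stabilizer states, i.e. unit vectors $|\psi\rangle\in\mathbb C^2$ with $P|\psi\rangle=|\psi\rangle$ for some $P\neq\mathbb 1$ in the Pauli group $\{i^m\sigma : m\in\mathbb N,\ \sigma\in\{\mathbb 1,X,Y,Z\}\}$. For a unit vector $|\Psi\rangle\in\mathbb C^2$ let $$\xi(\Psi)=\min\Big\{\Big(\sum_j|c_j|\Big)^2 : |\Psi\rangle=\sum_j c_j|\phi_j\rangle,\ c_j\in\mathbb C,\ |\phi_j\rangle\in\mathrm S_1\Big\},$$ and for a single-qubit density matrix $\rho$ let $$\Xi(\rho)=\min\Big\{\sum_j p_j\,\xi(\Psi_j) : \rho=\sum_j p_j|\Psi_j\rangle\langle\Psi_j|,\ p_j\ge 0,\ \sum_j p_j=1,\ |\Psi_j\rangle \text{ unit vectors}\Big\},$$ $$\Lambda(\rho)=\min\Big\{\sum_j|\alpha_j| : \rho=\sum_j\alpha_j|L_j\rangle\langle R_j|,\ \alpha_j\in\mathbb C,\ |L_j\rangle,|R_j\rangle\in\mathrm S_1\Big\},$$ $$\Lambda^+(\rho)=\max\big\{\mathrm{Tr}[W\rho]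 : W\ge 0,\ |\langle L|W|R\rangle|\le 1 \text{ for all } |L\rangle,|R\rangle\in\mathrm S_1\big\},$$ where all decompositions are finite. These minima and the maximum exist, and for every single-qubit density matrix $\rho$, $$\Lambda^+(\rho)=\Lambda(\rho)=\Xi(\rho).$$ Furthermore $\rho$ admits an equimagical decomposition: the minimum defining $\Xi(\rho)$ is achieved by a decomposition $\rho=\sum_j p_j|\Psi_j\rangle\langle\Psi_j|$ in which all the $\xi(\Psi_j)$ are equal. -/

import Mathlib

open Matrix
open scoped ComplexOrder

namespace Magic

section General

variable {d : Type*} [Fintype d]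

/-- A ket: a unit vector of `ℂ^d`. -/
def IsKet (ψ : d → ℂ) : Prop := star ψ ⬝ᵥ ψ = 1

/-- A (possibly mixed) quantum state: a density matrix. -/
def IsState (ρ : Matrix d d ℂ) : Prop := ρ.PosSemidef ∧ ρ.trace = 1

/-- The dyad `|L⟩⟨R|`. -/
def dyad (L R : d → ℂ) : Matrix d d ℂ := vecMulVec L (star R)

/-- The matrix element `⟨L|W|R⟩`. -/
def braket (L : d → ℂ) (W : Matrix d d ℂ) (R : d → ℂ) : ℂ := star L ⬝ᵥ (W *ᵥ R)

/-- The values `‖c‖₁²` over all finite decompositions `ψ = ∑ c_j φ_j` with complex coefficients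
and kets `φ_j` in the free set `S`. -/
def extentValues (S : Set (d → ℂ)) (ψ : d → ℂ) : Set ℝ :=
  {x | ∃ (k : ℕ) (c : Fin k → ℂ) (φ : Fin k → d → ℂ),
    (∀ j, φ j ∈ S) ∧ ψ = ∑ j, c j • φ j ∧ x = (∑ j, ‖c j‖) ^ 2}

/-- The pure-state extent `ξ`. -/
noncomputable def extent (S : Set (d → ℂ)) (ψ : d → ℂ) : ℝ := sInf (extentValues S ψ)

/-- `ρ = ∑ p_j |Ψ_j⟩⟨Ψ_j|` is a convex decomposition of `ρ` into pure states. -/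
def IsPureDecomposition (ρ : Matrix d d ℂ) {k : ℕ} (p : Fin k → ℝ) (Ψ : Fin k → d → ℂ) : Prop :=
  (∀ j, 0 ≤ p j) ∧ ∑ j, p j = 1 ∧ (∀ j, IsKet (Ψ j)) ∧
    ρ = ∑ j, (p j : ℂ) • dyad (Ψ j) (Ψ j)

/-- The values `∑ p_j ξ(Ψ_j)` over all convex decompositions of `ρ` into pure states. -/
def mixedExtentValues (S : Set (d → ℂ)) (ρ : Matrix d d ℂ) : Set ℝ :=
  {x | ∃ (k : ℕ) (p : Fin k → ℝ) (Ψ : Fin k → d → ℂ),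
    IsPureDecomposition ρ p Ψ ∧ x = ∑ j, p j * extent S (Ψ j)}

/-- The mixed-state extent `Ξ`. -/
noncomputable def mixedExtent (S : Set (d → ℂ)) (ρ : Matrix d d ℂ) : ℝ :=
  sInf (mixedExtentValues S ρ)

/-- `ρ` admits an equimagical decomposition: the minimum defining `Ξ(ρ)` is achieved by a
decomposition all of whose pure states have the same extent. -/
def IsEquimagical (S : Set (d → ℂ)) (ρ : Matrix d d ℂ) : Prop :=
  ∃ (k : ℕ) (p : Fin k → ℝ) (Ψ : Fin k → d → ℂ),
    IsPureDecomposition ρ p Ψ ∧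
    IsLeast (mixedExtentValues S ρ) (∑ j, p j * extent S (Ψ j)) ∧
    ∀ i j, extent S (Ψ i) = extent S (Ψ j)

/-- The values `‖α‖₁` over all finite decompositions `ρ = ∑ α_j |L_j⟩⟨R_j|` with complex
coefficients and kets `L_j, R_j` in the free set `S`. -/
def dyadicValues (S : Set (d → ℂ)) (ρ : Matrix d d ℂ) : Set ℝ :=
  {x | ∃ (k : ℕ) (α : Fin k → ℂ) (L R : Fin k → d → ℂ),
    (∀ j, L j ∈ S) ∧ (∀ j, R j ∈ S) ∧ ρ = ∑ j, α j • dyad (L j) (R j) ∧ x = ∑ j, ‖α j‖}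

/-- The dyadic negativity `Λ`. -/
noncomputable def dyadicNegativity (S : Set (d → ℂ)) (ρ : Matrix d d ℂ) : ℝ :=
  sInf (dyadicValues S ρ)

/-- The set `𝒲` of `W`-witnesses. -/
def witnesses (S : Set (d → ℂ)) : Set (Matrix d d ℂ) :=
  {W | W.IsHermitian ∧ ∀ L ∈ S, ∀ R ∈ S, ‖braket L W R‖ ≤ 1}

/-- The values `Tr[W ρ]` over the positive semidefinite `W`-witnesses. (`W` and `ρ` being
Hermitian, the trace is real.) -/
def robustnessValues (S : Set (d → ℂ)) (ρ : Matrix d d ℂ) : Set ℝ :=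
  {x | ∃ W ∈ witnesses S, W.PosSemidef ∧ x = (W * ρ).trace.re}

/-- The generalized robustness `Λ⁺`. -/
noncomputable def generalizedRobustness (S : Set (d → ℂ)) (ρ : Matrix d d ℂ) : ℝ :=
  sSup (robustnessValues S ρ)

end General

/-- The Pauli matrix `X`. -/
def pauliX : Matrix (Fin 2) (Fin 2) ℂ := !![0, 1; 1, 0]

/-- The Pauli matrix `Y`. -/
def pauliY : Matrix (Fin 2) (Fin 2) ℂ := !![0, -Complex.I; Complex.I, 0]

/-- The Pauli matrix `Z`. -/
def pauliZ : Matrix (Fin 2) (Fin 2) ℂ := !![1, 0; 0, -1]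

/-- The single-qubit Pauli group: the matrices `1, X, Y, Z` times a power of `i`. -/
def pauliGroup : Set (Matrix (Fin 2) (Fin 2) ℂ) :=
  {P | ∃ m : ℕ, ∃ σ ∈ ({1, pauliX, pauliY, pauliZ} : Set (Matrix (Fin 2) (Fin 2) ℂ)),
    P = Complex.I ^ m • σ}

/-- The pure single-qubit stabilizer states (as kets, with arbitrary global phase): unit vectors
fixed by a non-identity element of the Pauli group. -/
def stabilizerKets : Set (Fin 2 → ℂ) :=
  {ψ | IsKet ψ ∧ ∃ P ∈ pauliGroup, P ≠ 1 ∧ P *ᵥ ψ = ψ}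

end Magic

namespace Magic

/-! ### Bookkeeping for dyadic decompositions. -/

section Decomposition

variable {d : Type*}

/-! Weak duality comes for free. Pairing a witness with a dyadic decomposition gives `Tr[Wρ] ≤ ∑
|α_j|`, and expanding both sides of each `|Ψ_j⟩⟨Ψ_j|` turns a pure-state decomposition into a dyadic
one of the same cost. So it suffices to find, for every Bloch vector `r` in the unit ball, a number
`v` with matching certificates: a positive semidefinite witness of value `v` at `r`, and a
representation of `r` as a mixture of pure states of extent at most `v` (`hasCertificate`). The
average extent is then squeezed to `v`, and since the weights are positive every extent equals `v`,
which is equimagicality.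

For positive semidefinite `W = A + w·σ`, Cauchy–Schwarz reduces the witness condition to expectation
values in stabilizer states, that is, to `A + |w_i| ≤ 1`. Antiunitary Clifford symmetries reduce `r
= (x, y, z)` to `x ≥ y ≥ z ≥ 0`, where there are three cases. In the stabilizer octahedron, `v = 1`
and `W = 1`. Near the edge joining `|+⟩` and `|+i⟩`, pure states are expanded in these two kets
(`extentLE_two`). Near the centre of the face, they are expanded in `|+⟩`, `|+i⟩`, `|0⟩`
(`extentLE_three`). In the last two cases the bound on the extent is unchanged along lines of
direction `(1, -1, 0)`, so `r` can be moved along such a line to the sphere or, in the face case, to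
the boundary with the edge case. -/

theorem mem_dyadicValues_of_fintype {S : Set (d → ℂ)} {ρ : Matrix d d ℂ} {ι : Type*} [Fintype ι]
    (α : ι → ℂ) (L R : ι → d → ℂ) (hL : ∀ j, L j ∈ S) (hR : ∀ j, R j ∈ S)
    (hρ : ρ = ∑ j, α j • dyad (L j) (R j)) : ∑ j, ‖α j‖ ∈ dyadicValues S ρ := by
  let e := (Fintype.equivFin ι).symm
  refine ⟨_, α ∘ e, L ∘ e, R ∘ e, fun j => hL _, fun j => hR _, ?_, ?_⟩
  · rw [hρ]; exact (e.sum_comp fun j => α j • dyad (L j) (R j)).symm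
  · exact (e.sum_comp fun j => ‖α j‖).symm

theorem dyad_sum_smul {k : ℕ} (c : Fin k → ℂ) (φ : Fin k → d → ℂ) :
    dyad (∑ a, c a • φ a) (∑ a, c a • φ a)
      = ∑ a, ∑ b, (c a * star (c b)) • dyad (φ a) (φ b) := by
  ext i j
  simp only [dyad, vecMulVec_apply, Pi.star_apply, Finset.sum_apply, Pi.smul_apply, smul_eq_mul,
    Matrix.sum_apply, Matrix.smul_apply, star_sum, star_mul', Finset.sum_mul_sum]
  refine Finset.sum_congr rfl fun a _ => Finset.sum_congr rfl fun b _ => by ring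

end Decomposition

/-! ### Weak duality between witnesses and decompositions. -/

section Duality

variable {d : Type*} [Fintype d]

/-- Cauchy–Schwarz for the semi-inner product `⟨BL, BR⟩`, where `W = Bᴴ B`. It lets a positive
semidefinite witness be checked on diagonal matrix elements only. -/
theorem norm_braket_sq_le [DecidableEq d] {W : Matrix d d ℂ} (hW : W.PosSemidef)
    (L R : d → ℂ) : ‖braket L W R‖ ^ 2 ≤ ‖braket L W L‖ * ‖braket R W R‖ := by
  obtain ⟨B, rfl⟩ : ∃ B : Matrix d d ℂ, W = Bᴴ * B := by
    open scoped MatrixOrder in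
    exact CStarAlgebra.nonneg_iff_eq_star_mul_self.mp hW.nonneg
  have h : ∀ u v : d → ℂ, braket u (Bᴴ * B) v
      = inner ℂ (WithLp.toLp 2 (B *ᵥ u)) (WithLp.toLp 2 (B *ᵥ v)) := by
    intro u v
    rw [braket, EuclideanSpace.inner_toLp_toLp, ← mulVec_mulVec, dotProduct_mulVec, star_mulVec,
      dotProduct_comm]
  rw [h, h, h, inner_self_eq_norm_sq_to_K, inner_self_eq_norm_sq_to_K]
  have := norm_inner_le_norm (𝕜 := ℂ) (WithLp.toLp 2 (B *ᵥ L)) (WithLp.toLp 2 (B *ᵥ R))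
  simp only [norm_pow, Complex.coe_algebraMap, Complex.norm_real, norm_norm]
  rw [← mul_pow]
  gcongr

theorem trace_mul_dyad (W : Matrix d d ℂ) (L R : d → ℂ) :
    (W * dyad L R).trace = braket R W L := by
  rw [dyad, mul_vecMulVec, trace_vecMulVec, braket, dotProduct_comm]

theorem re_trace_le_of_mem_dyadicValues {S : Set (d → ℂ)} {ρ W : Matrix d d ℂ}
    (hW : W ∈ witnesses S) {y : ℝ} (hy : y ∈ dyadicValues S ρ) : (W * ρ).trace.re ≤ y := by
  obtain ⟨k, α, L, R, hL, hR, rfl, rfl⟩ := hy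
  refine (Complex.re_le_norm _).trans ?_
  rw [Matrix.mul_sum, trace_sum]
  refine norm_sum_le_of_le _ fun j _ => ?_
  rw [mul_smul_comm, trace_smul, trace_mul_dyad, smul_eq_mul, norm_mul]
  exact mul_le_of_le_one_right (norm_nonneg _) (hW.2 _ (hR j) _ (hL j))

/-- Expanding both the ket and the bra of `|Ψ_j⟩⟨Ψ_j|` produces `∑ |c_a| |c_b|`, the square of the
`ℓ¹`-norm; this is why the extent is defined with a square. -/
theorem sum_mul_mem_dyadicValues {S : Set (d → ℂ)} {ρ : Matrix d d ℂ} {k : ℕ}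
    {p : Fin k → ℝ} {Ψ : Fin k → d → ℂ} (h : IsPureDecomposition ρ p Ψ) {x : Fin k → ℝ}
    (hx : ∀ j, x j ∈ extentValues S (Ψ j)) : ∑ j, p j * x j ∈ dyadicValues S ρ := by
  choose n c φ hφ hΨ hx using hx
  have key := mem_dyadicValues_of_fintype (S := S) (ρ := ρ) (ι := Σ j, Fin (n j) × Fin (n j))
    (fun i => (p i.1 : ℂ) * (c i.1 i.2.1 * star (c i.1 i.2.2)))
    (fun i => φ i.1 i.2.1) (fun i => φ i.1 i.2.2) (fun i => hφ _ _) (fun i => hφ _ _) (by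
      rw [h.2.2.2, Fintype.sum_sigma]
      refine Finset.sum_congr rfl fun j _ => ?_
      conv_lhs => rw [hΨ j]
      rw [dyad_sum_smul, Fintype.sum_prod_type, Finset.smul_sum]
      simp only [Finset.smul_sum, smul_smul])
  convert key using 1
  rw [Fintype.sum_sigma]
  refine Finset.sum_congr rfl fun j _ => ?_
  rw [hx j, sq, Finset.sum_mul_sum, Fintype.sum_prod_type, Finset.mul_sum]
  simp only [Finset.mul_sum, norm_mul, norm_star, Complex.norm_real,
    Real.norm_of_nonneg (h.1 j)]

theorem IsKet.isPureDecomposition_dyad {ψ : d → ℂ} (hψ : IsKet ψ) :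
    IsPureDecomposition (dyad ψ ψ) (fun _ : Fin 1 => (1 : ℝ)) fun _ => ψ :=
  ⟨fun _ => zero_le_one, by simp, fun _ => hψ, by simp⟩

theorem extentValues_subset_dyadicValues {S : Set (d → ℂ)} {ψ : d → ℂ} (hψ : IsKet ψ) :
    extentValues S ψ ⊆ dyadicValues S (dyad ψ ψ) := fun x hx => by
  simpa using sum_mul_mem_dyadicValues (hψ.isPureDecomposition_dyad)
    (x := fun _ => x) fun _ => hx

end Duality

/-! ### Bloch-ball coordinates for kets, states and Hermitian matrices. -/

section Bloch

/-- The Bloch vector of a vector of `ℂ²`. -/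
def bloch (ψ : Fin 2 → ℂ) : ℝ × ℝ × ℝ :=
  (2 * ((ψ 0).re * (ψ 1).re + (ψ 0).im * (ψ 1).im),
    2 * ((ψ 0).re * (ψ 1).im - (ψ 0).im * (ψ 1).re),
    (ψ 0).re ^ 2 + (ψ 0).im ^ 2 - ((ψ 1).re ^ 2 + (ψ 1).im ^ 2))

/-- The squared Euclidean norm of a Bloch vector. -/
def sqNorm (r : ℝ × ℝ × ℝ) : ℝ := r.1 ^ 2 + r.2.1 ^ 2 + r.2.2 ^ 2

/-- The Hermitian matrix `A + x X + y Y + z Z`. -/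
def pauliComb (A : ℝ) (r : ℝ × ℝ × ℝ) : Matrix (Fin 2) (Fin 2) ℂ :=
  !![⟨A + r.2.2, 0⟩, ⟨r.1, -r.2.1⟩; ⟨r.1, r.2.1⟩, ⟨A - r.2.2, 0⟩]

theorem isKet_iff {ψ : Fin 2 → ℂ} : IsKet ψ ↔
    (ψ 0).re ^ 2 + (ψ 0).im ^ 2 + ((ψ 1).re ^ 2 + (ψ 1).im ^ 2) = 1 := by
  simp only [IsKet, dotProduct, Fin.sum_univ_two, Pi.star_apply, Complex.ext_iff, Complex.add_re,
    Complex.add_im, Complex.mul_re, Complex.mul_im, Complex.star_def, Complex.conj_re,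
    Complex.conj_im, Complex.one_re, Complex.one_im]
  constructor
  · rintro ⟨h, -⟩; linear_combination h
  · intro h; exact ⟨by linear_combination h, by ring⟩

theorem sqNorm_bloch (ψ : Fin 2 → ℂ) : sqNorm (bloch ψ)
    = ((ψ 0).re ^ 2 + (ψ 0).im ^ 2 + ((ψ 1).re ^ 2 + (ψ 1).im ^ 2)) ^ 2 := by
  simp only [sqNorm, bloch]; ring

theorem IsKet.sqNorm_bloch {ψ : Fin 2 → ℂ} (h : IsKet ψ) : sqNorm (bloch ψ) = 1 := by
  rw [Magic.sqNorm_bloch, isKet_iff.1 h, one_pow]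

theorem braket_pauliComb (A : ℝ) (w : ℝ × ℝ × ℝ) (ψ : Fin 2 → ℂ) :
    braket ψ (pauliComb A w) ψ
      = ((A * ((ψ 0).re ^ 2 + (ψ 0).im ^ 2 + ((ψ 1).re ^ 2 + (ψ 1).im ^ 2))
        + (w.1 * (bloch ψ).1 + w.2.1 * (bloch ψ).2.1 + w.2.2 * (bloch ψ).2.2) : ℝ) : ℂ) := by
  simp only [braket, pauliComb, bloch, dotProduct, mulVec, Fin.sum_univ_two, Pi.star_apply,
    Complex.ext_iff, Complex.add_re,
    Complex.add_im, Complex.mul_re, Complex.mul_im, Complex.star_def, Complex.conj_re,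
    Complex.conj_im, Complex.ofReal_re, Complex.ofReal_im, of_apply, cons_val_zero, cons_val_one,
    cons_val', cons_val_fin_one]
  constructor <;> ring

theorem isHermitian_pauliComb (A : ℝ) (w : ℝ × ℝ × ℝ) : (pauliComb A w).IsHermitian := by
  ext i j
  fin_cases i <;> fin_cases j <;> simp [pauliComb, Complex.ext_iff]

theorem abs_inner_le_of_sqNorm_le {w r : ℝ × ℝ × ℝ} {a b : ℝ} (ha : 0 ≤ a) (hb : 0 ≤ b)
    (hw : sqNorm w ≤ a ^ 2) (hr : sqNorm r ≤ b ^ 2) :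
    |w.1 * r.1 + w.2.1 * r.2.1 + w.2.2 * r.2.2| ≤ a * b := by
  refine abs_le_of_sq_le_sq ?_ (by positivity)
  have h : sqNorm w * sqNorm r ≤ a ^ 2 * b ^ 2 := by
    refine mul_le_mul hw hr ?_ (by positivity)
    simp only [sqNorm]; positivity
  simp only [sqNorm] at h
  nlinarith [sq_nonneg (w.1 * r.2.1 - w.2.1 * r.1), sq_nonneg (w.1 * r.2.2 - w.2.2 * r.1),
    sq_nonneg (w.2.1 * r.2.2 - w.2.2 * r.2.1)]

theorem posSemidef_pauliComb {A : ℝ} {w : ℝ × ℝ × ℝ} (hA : 0 ≤ A) (hw : sqNorm w ≤ A ^ 2) :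
    (pauliComb A w).PosSemidef := by
  refine .of_dotProduct_mulVec_nonneg (isHermitian_pauliComb A w) fun ψ => ?_
  change 0 ≤ braket ψ _ ψ
  rw [braket_pauliComb]
  have := abs_inner_le_of_sqNorm_le hA (by positivity) hw (sqNorm_bloch ψ).le
  exact_mod_cast by linarith [(abs_le.1 this).1]

theorem dyad_self_eq {ψ : Fin 2 → ℂ} (h : IsKet ψ) :
    dyad ψ ψ = pauliComb (1 / 2) ((1 / 2 : ℝ) • bloch ψ) := by
  have h := isKet_iff.1 h
  ext i j
  fin_cases i <;> fin_cases j <;> apply Complex.ext <;>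
    simp [dyad, vecMulVec_apply, pauliComb, bloch] <;>
    first | ring1 | linear_combination (1 / 2) * h

theorem re_trace_pauliComb_mul (A B : ℝ) (w r : ℝ × ℝ × ℝ) :
    (pauliComb A w * pauliComb B r).trace.re
      = 2 * (A * B + (w.1 * r.1 + w.2.1 * r.2.1 + w.2.2 * r.2.2)) := by
  simp only [pauliComb, trace_fin_two, mul_apply, Fin.sum_univ_two, of_apply, cons_val_zero,
    cons_val_one, cons_val', cons_val_fin_one, Complex.add_re, Complex.mul_re]
  ring

theorem IsState.exists_eq_pauliComb {ρ : Matrix (Fin 2) (Fin 2) ℂ} (h : IsState ρ) :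
    ∃ r, sqNorm r ≤ 1 ∧ ρ = pauliComb (1 / 2) ((1 / 2 : ℝ) • r) := by
  have hd := h.1.det_nonneg
  have ht := h.2
  have h0 := h.1.1.apply 0 0
  have h1 := h.1.1.apply 1 1
  have h2 := h.1.1.apply 0 1
  rw [det_fin_two] at hd
  rw [trace_fin_two] at ht
  simp only [Complex.ext_iff, Complex.le_def, Complex.star_def, Complex.conj_re, Complex.conj_im,
    Complex.add_re, Complex.add_im, Complex.sub_re, Complex.mul_re, Complex.sub_im, Complex.mul_im,
    Complex.zero_re, Complex.zero_im, Complex.one_re, Complex.one_im] at hd ht h0 h1 h2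
  have e0 : (ρ 0 0).im = 0 := by linarith
  have e1 : (ρ 1 1).im = 0 := by linarith
  refine ⟨(2 * (ρ 1 0).re, 2 * (ρ 1 0).im, (ρ 0 0).re - (ρ 1 1).re), ?_, ?_⟩
  · have e2 : (ρ 0 1).im = -(ρ 1 0).im := by linarith
    rw [e0, e1, e2, ← h2.1] at hd
    simp only [sqNorm]
    have e3 : (ρ 0 0).re = 1 - (ρ 1 1).re := by linarith
    rw [e3] at hd ⊢
    nlinarith [hd.1]
  · ext i j
    fin_cases i <;> fin_cases j <;> simp [pauliComb, Complex.ext_iff] <;> constructor <;> linarith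

theorem exists_ket_bloch_eq {r : ℝ × ℝ × ℝ} (h : sqNorm r = 1) :
    ∃ ψ, IsKet ψ ∧ bloch ψ = r := by
  obtain ⟨x, y, z⟩ := r
  simp only [sqNorm] at h
  -- The ket below is normalized to have a positive first entry, which excludes the south pole.
  by_cases hz : z = -1
  · subst hz
    have hx : x = 0 := by nlinarith [sq_nonneg x, sq_nonneg y]
    have hy : y = 0 := by nlinarith [sq_nonneg x, sq_nonneg y]
    exact ⟨![0, 1], by simp [isKet_iff], by simp [bloch, hx, hy]⟩
  · have hz1 : -1 < z := lt_of_le_of_ne (by nlinarith [sq_nonneg x, sq_nonneg y]) (Ne.symm hz)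
    set s := √((1 + z) / 2) with hs
    have hs2 : s ^ 2 = (1 + z) / 2 := Real.sq_sqrt (by linarith)
    have hs0 : 0 < s := Real.sqrt_pos.2 (by linarith)
    have e : (x / (2 * s)) ^ 2 + (y / (2 * s)) ^ 2 = (1 - z) / 2 := by
      field_simp
      rw [hs2]
      linear_combination h
    refine ⟨![(s : ℂ), ⟨x / (2 * s), y / (2 * s)⟩], ?_, ?_⟩
    · rw [isKet_iff]; simp only [cons_val_zero, cons_val_one, Complex.ofReal_re, Complex.ofReal_im, cons_val_fin_one]
      linear_combination e + hs2
    · simp only [bloch, cons_val_zero, cons_val_one, Complex.ofReal_re, Complex.ofReal_im,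
        cons_val_fin_one, Prod.mk.injEq]
      refine ⟨by field_simp; ring, by field_simp; ring, by linear_combination hs2 - e⟩

theorem pauliComb_sum {ι : Type*} [Fintype ι] (p : ι → ℝ) (s : ι → ℝ × ℝ × ℝ)
    (hp : ∑ j, p j = 1) :
    pauliComb (1 / 2) ((1 / 2 : ℝ) • ∑ j, p j • s j)
      = ∑ j, (p j : ℂ) • pauliComb (1 / 2) ((1 / 2 : ℝ) • s j) := by
  ext i j
  fin_cases i <;> fin_cases j <;>
    simp [pauliComb, Complex.ext_iff, Matrix.sum_apply, Prod.fst_sum, Prod.snd_sum, mul_add,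
      mul_sub, Finset.mul_sum, Finset.sum_add_distrib, ← Finset.sum_mul, hp, mul_left_comm]

end Bloch

/-! ### Stabilizer kets as the six octahedron vertices, and Bloch witnesses. -/

section Stabilizer

theorem pauliX_mulVec (ψ : Fin 2 → ℂ) : pauliX *ᵥ ψ = ![ψ 1, ψ 0] := by
  ext i; fin_cases i <;> simp [pauliX, mulVec, dotProduct]

theorem pauliY_mulVec (ψ : Fin 2 → ℂ) :
    pauliY *ᵥ ψ = ![-Complex.I * ψ 1, Complex.I * ψ 0] := by
  ext i; fin_cases i <;> simp [pauliY, mulVec, dotProduct]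

theorem pauliZ_mulVec (ψ : Fin 2 → ℂ) : pauliZ *ᵥ ψ = ![ψ 0, -ψ 1] := by
  ext i; fin_cases i <;> simp [pauliZ, mulVec, dotProduct]

theorem abs_eq_one_of_I_pow_mul_eq_one {m : ℕ} {x : ℝ} (h : Complex.I ^ m * x = 1) : |x| = 1 := by
  simpa using congrArg norm h

theorem abs_bloch_eq_one_of_mem_stabilizerKets {ψ : Fin 2 → ℂ} (h : ψ ∈ stabilizerKets) :
    |(bloch ψ).1| = 1 ∨ |(bloch ψ).2.1| = 1 ∨ |(bloch ψ).2.2| = 1 := by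
  obtain ⟨hk, P, ⟨m, σ, hσ, rfl⟩, hP, hψ⟩ := h
  have key : Complex.I ^ m * (star ψ ⬝ᵥ (σ *ᵥ ψ)) = 1 := by
    have := congrArg (star ψ ⬝ᵥ ·) hψ
    simp only [smul_mulVec, dotProduct_smul, smul_eq_mul] at this
    rw [this]; exact hk
  rcases hσ with rfl | rfl | rfl | rfl
  -- For `σ = 1` the phase is forced to be `1`, contradicting `P ≠ 1`.
  · rw [one_mulVec, show star ψ ⬝ᵥ ψ = 1 from hk, mul_one] at key
    simp [key] at hP
  · left
    refine abs_eq_one_of_I_pow_mul_eq_one (m := m) ?_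
    rw [← key, pauliX_mulVec]
    congr 1
    simp [dotProduct, bloch, Complex.ext_iff, sq]
    constructor <;> ring
  · right; left
    refine abs_eq_one_of_I_pow_mul_eq_one (m := m) ?_
    rw [← key, pauliY_mulVec]
    congr 1
    simp [dotProduct, bloch, Complex.ext_iff, sq]
    constructor <;> ring
  · right; right
    refine abs_eq_one_of_I_pow_mul_eq_one (m := m) ?_
    rw [← key, pauliZ_mulVec]
    congr 1
    simp [dotProduct, bloch, Complex.ext_iff, sq]
    constructor <;> ring

theorem mem_stabilizerKets_of_abs_bloch {ψ : Fin 2 → ℂ} (hk : IsKet ψ)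
    (h : |(bloch ψ).1| = 1 ∨ |(bloch ψ).2.1| = 1 ∨ |(bloch ψ).2.2| = 1) :
    ψ ∈ stabilizerKets := by
  have hk' := isKet_iff.1 hk
  simp only [bloch, abs_eq zero_le_one] at h
  -- In each case below, a Bloch coordinate `±1` makes a sum of two squares vanish, which is the
  -- eigenvector equation. The phases `I ^ 0` and `I ^ 2` realize the eigenvalues `1` and `-1`.
  have sq0 : ∀ {a b : ℝ}, a ^ 2 + b ^ 2 = 0 → a = 0 ∧ b = 0 := fun {a b} h =>
    ⟨by nlinarith [sq_nonneg a, sq_nonneg b], by nlinarith [sq_nonneg a, sq_nonneg b]⟩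
  refine ⟨hk, ?_⟩
  rcases h with (h | h) | (h | h) | (h | h)
  · refine ⟨Complex.I ^ 0 • pauliX, ⟨0, _, by simp, rfl⟩, fun e => ?_, ?_⟩
    · simpa [pauliX] using congrFun (congrFun e 0) 1
    · obtain ⟨h1, h2⟩ := sq0 (a := (ψ 0).re - (ψ 1).re) (b := (ψ 0).im - (ψ 1).im)
        (by linear_combination hk' - h)
      rw [smul_mulVec, pauliX_mulVec]
      ext i; fin_cases i <;> simp [Complex.ext_iff] <;> constructor <;> linarith
  · refine ⟨Complex.I ^ 2 • pauliX, ⟨2, _, by simp, rfl⟩, fun e => ?_, ?_⟩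
    · simpa [pauliX] using congrFun (congrFun e 0) 1
    · obtain ⟨h1, h2⟩ := sq0 (a := (ψ 0).re + (ψ 1).re) (b := (ψ 0).im + (ψ 1).im)
        (by linear_combination hk' + h)
      rw [smul_mulVec, pauliX_mulVec]
      ext i; fin_cases i <;> simp [Complex.ext_iff] <;> constructor <;> linarith
  · refine ⟨Complex.I ^ 0 • pauliY, ⟨0, _, by simp, rfl⟩, fun e => ?_, ?_⟩
    · simpa [pauliY] using congrFun (congrFun e 0) 1
    · obtain ⟨h1, h2⟩ := sq0 (a := (ψ 0).re - (ψ 1).im) (b := (ψ 0).im + (ψ 1).re)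
        (by linear_combination hk' - h)
      rw [smul_mulVec, pauliY_mulVec]
      ext i; fin_cases i <;> simp [Complex.ext_iff] <;> constructor <;> linarith
  · refine ⟨Complex.I ^ 2 • pauliY, ⟨2, _, by simp, rfl⟩, fun e => ?_, ?_⟩
    · simpa [pauliY] using congrFun (congrFun e 0) 1
    · obtain ⟨h1, h2⟩ := sq0 (a := (ψ 0).re + (ψ 1).im) (b := (ψ 0).im - (ψ 1).re)
        (by linear_combination hk' + h)
      rw [smul_mulVec, pauliY_mulVec]
      ext i; fin_cases i <;> simp [Complex.ext_iff] <;> constructor <;> linarith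
  · refine ⟨Complex.I ^ 0 • pauliZ, ⟨0, _, by simp, rfl⟩, fun e => ?_, ?_⟩
    · have := congrFun (congrFun e 1) 1
      norm_num [pauliZ, Complex.ext_iff] at this
    · obtain ⟨h1, h2⟩ := sq0 (a := (ψ 1).re) (b := (ψ 1).im)
        (by linear_combination (hk' - h) / 2)
      rw [smul_mulVec, pauliZ_mulVec]
      ext i; fin_cases i <;> simp [Complex.ext_iff, h1, h2]
  · refine ⟨Complex.I ^ 2 • pauliZ, ⟨2, _, by simp, rfl⟩, fun e => ?_, ?_⟩
    · have := congrFun (congrFun e 0) 0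
      norm_num [pauliZ, Complex.ext_iff] at this
    · obtain ⟨h1, h2⟩ := sq0 (a := (ψ 0).re) (b := (ψ 0).im)
        (by linear_combination (hk' + h) / 2)
      rw [smul_mulVec, pauliZ_mulVec]
      ext i; fin_cases i <;> simp [Complex.ext_iff, h1, h2]

/-- `A + w·σ` is positive semidefinite and its expectation values in stabilizer states are at
most `1`. -/
def IsBlochWitness (A : ℝ) (w : ℝ × ℝ × ℝ) : Prop :=
  0 ≤ A ∧ sqNorm w ≤ A ^ 2 ∧ A + |w.1| ≤ 1 ∧ A + |w.2.1| ≤ 1 ∧ A + |w.2.2| ≤ 1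

theorem IsBlochWitness.norm_braket_self_le {A : ℝ} {w : ℝ × ℝ × ℝ} (h : IsBlochWitness A w)
    {ψ : Fin 2 → ℂ} (hψ : ψ ∈ stabilizerKets) : ‖braket ψ (pauliComb A w) ψ‖ ≤ 1 := by
  obtain ⟨hA, hw, h1, h2, h3⟩ := h
  have hn := hψ.1.sqNorm_bloch
  have hge := abs_inner_le_of_sqNorm_le hA zero_le_one hw (hn.le.trans (one_pow 2).ge)
  rw [braket_pauliComb, isKet_iff.1 hψ.1, Complex.norm_real, Real.norm_eq_abs, mul_one]
  rw [mul_one] at hge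
  rw [abs_of_nonneg (by linarith [(abs_le.1 hge).1])]
  have hs := abs_bloch_eq_one_of_mem_stabilizerKets hψ
  generalize bloch ψ = b at hn hs
  obtain ⟨x, y, z⟩ := b
  simp only [sqNorm] at hn hs ⊢
  have bound : ∀ {a b : ℝ}, |b| = 1 → A + |a| ≤ 1 → A + a * b ≤ 1 := fun {a b} hb ha => by
    have := le_abs_self (a * b)
    rw [abs_mul, hb, mul_one] at this
    linarith
  rcases hs with hs | hs | hs <;> have hs2 := congrArg (· ^ 2) hs <;>
    simp only [sq_abs, one_pow] at hs2
  · have h0 : y = 0 := by nlinarith [sq_nonneg y, sq_nonneg z]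
    have h0' : z = 0 := by nlinarith [sq_nonneg y, sq_nonneg z]
    simpa [h0, h0'] using bound hs h1
  · have h0 : x = 0 := by nlinarith [sq_nonneg x, sq_nonneg z]
    have h0' : z = 0 := by nlinarith [sq_nonneg x, sq_nonneg z]
    simpa [h0, h0'] using bound hs h2
  · have h0 : x = 0 := by nlinarith [sq_nonneg x, sq_nonneg y]
    have h0' : y = 0 := by nlinarith [sq_nonneg x, sq_nonneg y]
    simpa [h0, h0'] using bound hs h3

theorem IsBlochWitness.mem_witnesses {A : ℝ} {w : ℝ × ℝ × ℝ} (h : IsBlochWitness A w) :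
    pauliComb A w ∈ witnesses stabilizerKets := by
  refine ⟨isHermitian_pauliComb A w, fun L hL R hR => ?_⟩
  have := norm_braket_sq_le (posSemidef_pauliComb h.1 h.2.1) L R
  have := this.trans
    (mul_le_one₀ (h.norm_braket_self_le hL) (norm_nonneg _) (h.norm_braket_self_le hR))
  exact (sq_le_one_iff₀ (norm_nonneg _)).1 this

end Stabilizer

/-! ### Symmetries and explicit stabilizer decompositions of pure states. -/

section PureStates

/-- Kets with Bloch vector `s` have a stabilizer decomposition of squared `ℓ¹`-norm at most `v`. -/
def ExtentLE (s : ℝ × ℝ × ℝ) (v : ℝ) : Prop :=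
  ∀ ψ, IsKet ψ → bloch ψ = s → ∃ y ∈ extentValues stabilizerKets ψ, y ≤ v

theorem mem_extentValues_of_smul_eq {d : Type*} [Fintype d] {S : Set (d → ℂ)} {ψ : d → ℂ} {τ : ℂ}
    (hτ : τ ≠ 0) {k : ℕ} {a : Fin k → ℂ} {φ : Fin k → d → ℂ} (hφ : ∀ j, φ j ∈ S)
    (h : τ • ψ = ∑ j, a j • φ j) : ((∑ j, ‖a j‖) / ‖τ‖) ^ 2 ∈ extentValues S ψ := by
  refine ⟨k, fun j => τ⁻¹ * a j, φ, hφ, ?_, ?_⟩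
  · simp_rw [← smul_smul, ← Finset.smul_sum, ← h, smul_smul, inv_mul_cancel₀ hτ, one_smul]
  · simp_rw [norm_mul, ← Finset.mul_sum, norm_inv, div_eq_inv_mul]

theorem isKet_iff_sqNorm_bloch {ψ : Fin 2 → ℂ} : IsKet ψ ↔ sqNorm (bloch ψ) = 1 := by
  rw [isKet_iff, sqNorm_bloch, pow_eq_one_iff_of_nonneg (by positivity) two_ne_zero]

theorem mem_stabilizerKets_iff {ψ : Fin 2 → ℂ} : ψ ∈ stabilizerKets ↔ sqNorm (bloch ψ) = 1 ∧
    (|(bloch ψ).1| = 1 ∨ |(bloch ψ).2.1| = 1 ∨ |(bloch ψ).2.2| = 1) :=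
  ⟨fun h => ⟨h.1.sqNorm_bloch, abs_bloch_eq_one_of_mem_stabilizerKets h⟩,
    fun h => mem_stabilizerKets_of_abs_bloch (isKet_iff_sqNorm_bloch.2 h.1) h.2⟩

/-- A decomposition is transported by the antilinear map `ψ ↦ M ψ̄`; its coefficients are
conjugated, so the `ℓ¹`-norm is unchanged. Antilinear maps are needed because the reflections of the
Bloch sphere used here reverse orientation. -/
theorem extentLE_of_antilinear {M : Matrix (Fin 2) (Fin 2) ℂ} {g : ℝ × ℝ × ℝ → ℝ × ℝ × ℝ}
    (hM : ∀ ψ, M *ᵥ star (M *ᵥ star ψ) = ψ) (hg : ∀ ψ, bloch (M *ᵥ star ψ) = g (bloch ψ))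
    (hn : ∀ s, sqNorm (g s) = sqNorm s)
    (hs : ∀ s, (|s.1| = 1 ∨ |s.2.1| = 1 ∨ |s.2.2| = 1) →
      (|(g s).1| = 1 ∨ |(g s).2.1| = 1 ∨ |(g s).2.2| = 1))
    (hgg : ∀ s, g (g s) = s) {s : ℝ × ℝ × ℝ} {v : ℝ} (h : ExtentLE s v) : ExtentLE (g s) v := by
  intro ψ hψ hψs
  obtain ⟨y, ⟨k, c, φ, hφ, hc, rfl⟩, hy⟩ := h (M *ᵥ star ψ)
    (by rw [isKet_iff_sqNorm_bloch, hg, hn, hψ.sqNorm_bloch]) (by rw [hg, hψs, hgg])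
  refine ⟨_, ⟨k, star c, fun j => M *ᵥ star (φ j), fun j => ?_, ?_, rfl⟩, ?_⟩
  · have := mem_stabilizerKets_iff.1 (hφ j)
    rw [mem_stabilizerKets_iff, hg, hn]
    exact ⟨this.1, hs _ this.2⟩
  · rw [← hM ψ, hc, star_sum, mulVec_sum]
    simp [star_smul, mulVec_smul]
  · simpa using hy

/-- The reflection `x ↦ -x`. -/
def negX : (ℝ × ℝ × ℝ) →ₗ[ℝ] ℝ × ℝ × ℝ where
  toFun s := (-s.1, s.2.1, s.2.2)
  map_add' s t := by ext <;> simp [add_comm]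
  map_smul' a s := by ext <;> simp

/-- The reflection exchanging `x` and `y`. -/
def swapXY : (ℝ × ℝ × ℝ) →ₗ[ℝ] ℝ × ℝ × ℝ where
  toFun s := (s.2.1, s.1, s.2.2)
  map_add' s t := by ext <;> simp
  map_smul' a s := by ext <;> simp

/-- The reflection exchanging `x` and `z`. -/
def swapXZ : (ℝ × ℝ × ℝ) →ₗ[ℝ] ℝ × ℝ × ℝ where
  toFun s := (s.2.2, s.2.1, s.1)
  map_add' s t := by ext <;> simp
  map_smul' a s := by ext <;> simp

@[simp] theorem negX_apply (s : ℝ × ℝ × ℝ) : negX s = (-s.1, s.2.1, s.2.2) := rfl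
@[simp] theorem swapXY_apply (s : ℝ × ℝ × ℝ) : swapXY s = (s.2.1, s.1, s.2.2) := rfl
@[simp] theorem swapXZ_apply (s : ℝ × ℝ × ℝ) : swapXZ s = (s.2.2, s.2.1, s.1) := rfl

theorem ExtentLE.negX {s : ℝ × ℝ × ℝ} {v : ℝ} (h : ExtentLE s v) : ExtentLE (negX s) v := by
  refine extentLE_of_antilinear (M := !![1, 0; 0, -1]) (fun ψ => ?_) (fun ψ => ?_) (fun s => ?_)
    (fun s => ?_) (fun s => ?_) h
  · ext i; fin_cases i <;> simp [mulVec, dotProduct]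
  · simp only [bloch, mulVec, dotProduct, negX_apply, Prod.mk.injEq]
    refine ⟨?_, ?_, ?_⟩ <;> simp <;> ring
  · simp [sqNorm]
  · simp
  · simp

theorem ExtentLE.swapXY {s : ℝ × ℝ × ℝ} {v : ℝ} (h : ExtentLE s v) : ExtentLE (swapXY s) v := by
  refine extentLE_of_antilinear (M := !![1, 0; 0, Complex.I]) (fun ψ => ?_) (fun ψ => ?_)
    (fun s => ?_) (fun s => ?_) (fun s => ?_) h
  · ext i; fin_cases i <;> simp [mulVec, dotProduct, ← mul_assoc]
  · simp only [bloch, mulVec, dotProduct, swapXY_apply, Prod.mk.injEq]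
    refine ⟨?_, ?_, ?_⟩ <;> simp <;> ring
  · simp only [sqNorm, swapXY_apply]; ring
  · simp only [swapXY_apply]; tauto
  · simp

theorem half_eq_sqrt_half_mul_self : √(1 / 2) * √(1 / 2) = 1 / 2 :=
  Real.mul_self_sqrt (by norm_num)

theorem ExtentLE.swapXZ {s : ℝ × ℝ × ℝ} {v : ℝ} (h : ExtentLE s v) : ExtentLE (swapXZ s) v := by
  have hκ := half_eq_sqrt_half_mul_self
  generalize √(1 / 2) = κ at hκ
  have hκ' : (κ : ℂ) * κ = 1 / 2 := by rw [← Complex.ofReal_mul, hκ]; norm_num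
  refine extentLE_of_antilinear (M := !![(κ : ℂ), κ; κ, -κ]) (fun ψ => ?_) (fun ψ => ?_)
    (fun s => ?_) (fun s => ?_) (fun s => ?_) h
  · ext i; fin_cases i <;> simp [mulVec, dotProduct]
    · linear_combination 2 * ψ 0 * hκ'
    · linear_combination 2 * ψ 1 * hκ'
  · simp only [bloch, mulVec, dotProduct, swapXZ_apply, Prod.mk.injEq]
    refine ⟨?_, ?_, ?_⟩ <;> simp
    · linear_combination 2 * ((ψ 0).re ^ 2 + (ψ 0).im ^ 2 - (ψ 1).re ^ 2 - (ψ 1).im ^ 2) * hκ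
    · linear_combination 2 * ((ψ 0).re * (ψ 1).im - (ψ 0).im * (ψ 1).re) * hκ
    · linear_combination 4 * ((ψ 0).re * (ψ 1).re + (ψ 0).im * (ψ 1).im) * hκ
  · simp only [sqNorm, swapXZ_apply]; ring
  · simp only [swapXZ_apply]; tauto
  · simp

theorem extentLE_one_of_abs {s : ℝ × ℝ × ℝ} (h : |s.1| = 1 ∨ |s.2.1| = 1 ∨ |s.2.2| = 1) :
    ExtentLE s 1 := by
  rintro ψ hψ rfl
  exact ⟨1, ⟨1, fun _ => 1, fun _ => ψ, fun _ => mem_stabilizerKets_of_abs_bloch hψ h,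
    by simp, by simp⟩, le_rfl⟩

theorem basisZ_mem : (![1, 0] : Fin 2 → ℂ) ∈ stabilizerKets := by
  simp [mem_stabilizerKets_iff, bloch, sqNorm]

theorem basisX_mem : (![(√(1 / 2) : ℝ), (√(1 / 2) : ℝ)] : Fin 2 → ℂ) ∈ stabilizerKets := by
  have hκ := half_eq_sqrt_half_mul_self
  generalize √(1 / 2) = κ at hκ
  norm_num [mem_stabilizerKets_iff, bloch, sqNorm, hκ]

theorem basisY_mem :
    (![(√(1 / 2) : ℝ), (√(1 / 2) : ℝ) * Complex.I] : Fin 2 → ℂ) ∈ stabilizerKets := by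
  have hκ := half_eq_sqrt_half_mul_self
  generalize √(1 / 2) = κ at hκ
  norm_num [mem_stabilizerKets_iff, bloch, sqNorm, hκ]

/-- `|+⟩` and `|+i⟩` form a basis, and the coefficients of `ψ` in it have moduli `√(1 - y)` and `√(1
- x)`, being proportional to overlaps with the kets orthogonal to the other basis element. -/
theorem extentLE_two (x y z : ℝ) : ExtentLE (x, y, z) ((√(1 - x) + √(1 - y)) ^ 2) := by
  intro ψ hψ hs
  have hk := isKet_iff.1 hψ
  simp only [bloch, Prod.mk.injEq] at hs
  obtain ⟨hx, hy, -⟩ := hs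
  have hX := basisX_mem
  have hY := basisY_mem
  have hκ := half_eq_sqrt_half_mul_self
  generalize √(1 / 2) = κ at hκ hX hY
  have hκ' : (κ : ℂ) * κ = 1 / 2 := by rw [← Complex.ofReal_mul, hκ]; norm_num
  refine ⟨_, ⟨2, ![κ * (1 + Complex.I) * (ψ 1 - Complex.I * ψ 0),
    κ * (1 + Complex.I) * (ψ 0 - ψ 1)], ![![(κ : ℂ), κ], ![(κ : ℂ), κ * Complex.I]], ?_, ?_, rfl⟩,
    le_of_eq ?_⟩
  · intro j; fin_cases j
    exacts [hX, hY]
  · ext i; fin_cases i <;> simp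
    · linear_combination (-(2 * ψ 0)) * hκ' + κ * κ * ψ 0 * Complex.I_sq
    · linear_combination (-(2 * ψ 1)) * hκ' + κ * κ * ψ 1 * Complex.I_sq
  · rw [Fin.sum_univ_two]
    simp only [cons_val_zero, cons_val_one, cons_val_fin_one]
    rw [Complex.norm_def, Complex.norm_def, add_comm]
    congr 3 <;> simp [Complex.normSq_apply]
    · linear_combination 2 * hκ * (((ψ 0).re - (ψ 1).re) ^ 2 + ((ψ 0).im - (ψ 1).im) ^ 2) + hk - hx
    · linear_combination 2 * hκ * (((ψ 0).re - (ψ 1).im) ^ 2 + ((ψ 0).im + (ψ 1).re) ^ 2) + hk - hy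

/-- Let `T = (√3 + 1, 1 + i)`, an eigenvector of `X + Y + Z` with eigenvalue `√3`. With `φ_j` the
`+1` eigenkets of the Paulis and `s` the Bloch vector of `ψ`, the choice of `e` gives `|ψ⟩⟨ψ|T⟩ = ∑
(s_j - e) |φ_j⟩⟨φ_j|T⟩`, where the weights are nonnegative and all `|⟨φ_j|T⟩|` equal `√3 + 1`.
Dividing by `⟨ψ|T⟩` yields the decomposition. -/
theorem extentLE_three {x y z e : ℝ} (he : 0 ≤ e) (h : x + y + z = 1 + (3 + √3) * e)
    (hx : e ≤ x) (hy : e ≤ y) (hz : e ≤ z) : ExtentLE (x, y, z) (1 + √3 * e) := by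
  intro ψ hψ hs
  have hk := isKet_iff.1 hψ
  simp only [bloch, Prod.mk.injEq] at hs
  obtain ⟨bx, bY, bz⟩ := hs
  have hX := basisX_mem
  have hY := basisY_mem
  have hκ := half_eq_sqrt_half_mul_self
  generalize √(1 / 2) = κ at hκ hX hY
  have hκ' : (κ : ℂ) * κ = 1 / 2 := by rw [← Complex.ofReal_mul, hκ]; norm_num
  have ht : √3 ^ 2 = 3 := Real.sq_sqrt (by norm_num)
  have ht0 : 0 ≤ √3 := Real.sqrt_nonneg 3
  generalize √3 = t at *
  -- This is `⟨ψ|T⟩`. Its squared modulus is `(t + 1)² v` and the coefficients of `τ • ψ` have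
  -- `ℓ¹`-norm `(t + 1) v`, where `v = 1 + t e`, so the squared quotient is `v`.
  set τ : ℂ := star (ψ 0) * (t + 1) + star (ψ 1) * (1 + Complex.I) with hτ
  have hte : 0 ≤ t * e := mul_nonneg ht0 he
  have hτn : ‖τ‖ ^ 2 = (t + 1) ^ 2 * (1 + t * e) := by
    rw [← Complex.normSq_eq_norm_sq, Complex.normSq_apply]
    simp [hτ]
    linear_combination (t + 1) ^ 2 / 2 * (hk + bz) + hk - bz + (t + 1) * (bx + bY)
      + (t + 1) * h + ((1 + z) / 2 - (t + 1) * e - 1) * ht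
  have hτ0 : 0 < ‖τ‖ := by
    by_contra! h0
    have : ‖τ‖ = 0 := le_antisymm h0 (norm_nonneg _)
    rw [this] at hτn
    have : 0 < (t + 1) ^ 2 * (1 + t * e) := by positivity
    linarith
  have hτ1 : τ ≠ 0 := norm_pos_iff.1 hτ0
  have hn : ∀ a : ℝ, (a = 1 ∨ a = -1) → ‖(κ : ℂ) * (t + 2 + a * Complex.I)‖ = t + 1 := by
    intro a ha
    have ha2 : a ^ 2 = 1 := by rcases ha with rfl | rfl <;> norm_num
    rw [Complex.norm_def, Real.sqrt_eq_iff_eq_sq (Complex.normSq_nonneg _) (by positivity),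
      Complex.normSq_apply]
    simp
    linear_combination ((t + 2) ^ 2 + a ^ 2) * hκ + (1 / 2) * ha2 - ht / 2
  have hcoef : τ • ψ = ((z - e : ℝ) * (t + 1 : ℂ)) • ![(1 : ℂ), 0]
      + ((x - e : ℝ) * ((κ : ℂ) * (t + 2 + (1 : ℝ) * Complex.I))) • ![(κ : ℂ), κ]
      + ((y - e : ℝ) * ((κ : ℂ) * (t + 2 + (-1 : ℝ) * Complex.I))) • ![(κ : ℂ), κ * Complex.I] := by
    ext i
    fin_cases i <;> apply Complex.ext <;> simp [hτ]
    · linear_combination (t + 1) / 2 * (hk + bz) + (bx + bY) / 2 - hκ * (t + 2) * (x + y - 2 * e)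
        - (t + 1) / 2 * h - e / 2 * ht
    · linear_combination (bx - bY) / 2 - hκ * (x - y)
    · linear_combination (t + 1) / 2 * bx + (hk - bz) / 2 - hκ * ((x - e) * (t + 2) + (y - e))
        - h / 2
    · linear_combination (t + 1) / 2 * bY + (hk - bz) / 2 - hκ * ((x - e) + (y - e) * (t + 2))
        - h / 2
  refine ⟨_, mem_extentValues_of_smul_eq hτ1 (a := ![(z - e : ℝ) * (t + 1 : ℂ),
    (x - e : ℝ) * ((κ : ℂ) * (t + 2 + (1 : ℝ) * Complex.I)),
    (y - e : ℝ) * ((κ : ℂ) * (t + 2 + (-1 : ℝ) * Complex.I))])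
    (φ := ![![1, 0], ![(κ : ℂ), κ], ![(κ : ℂ), κ * Complex.I]]) ?_ ?_, le_of_eq ?_⟩
  · intro j; fin_cases j
    exacts [basisZ_mem, hX, hY]
  · rw [Fin.sum_univ_three]
    exact hcoef
  · rw [Fin.sum_univ_three]
    simp only [cons_val]
    have ht1 : ‖(t + 1 : ℂ)‖ = t + 1 := by
      rw [← Complex.ofReal_one, ← Complex.ofReal_add, Complex.norm_real,
        Real.norm_of_nonneg (by positivity)]
    have hs : ∀ {u : ℝ} (c : ℂ), e ≤ u → ‖((u - e : ℝ) : ℂ) * c‖ = (u - e) * ‖c‖ :=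
      fun c hu => by
        rw [norm_mul, Complex.norm_real, Real.norm_of_nonneg (sub_nonneg.2 hu)]
    rw [hs _ hx, hs _ hy, hs _ hz, hn 1 (.inl rfl), hn (-1) (.inr rfl), ht1]
    have : (z - e) * (t + 1) + (x - e) * (t + 1) + (y - e) * (t + 1)
        = (t + 1) * (1 + t * e) := by
      linear_combination (t + 1) * h
    rw [this, div_pow, hτn]
    have : (t + 1) ≠ 0 := by positivity
    have : 1 + t * e ≠ 0 := by positivity
    field_simp

end PureStates

/-! ### Convex hulls of low-extent pure states, and matching certificates. -/

section Geometry

/-- The convex hull of the Bloch vectors of pure states of extent at most `v`. -/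
def pureHull (v : ℝ) : Set (ℝ × ℝ × ℝ) := convexHull ℝ {s | sqNorm s = 1 ∧ ExtentLE s v}

theorem convex_pureHull (v : ℝ) : Convex ℝ (pureHull v) := convex_convexHull ℝ _

theorem ExtentLE.mono {s : ℝ × ℝ × ℝ} {v v' : ℝ} (h : ExtentLE s v) (hv : v ≤ v') :
    ExtentLE s v' := fun ψ hψ hs =>
  let ⟨y, hy, hyv⟩ := h ψ hψ hs
  ⟨y, hy, hyv.trans hv⟩

theorem mem_pureHull {s : ℝ × ℝ × ℝ} {v : ℝ} (hs : sqNorm s = 1) (h : ExtentLE s v) :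
    s ∈ pureHull v := subset_convexHull ℝ _ ⟨hs, h⟩

theorem map_mem_pureHull {g : (ℝ × ℝ × ℝ) →ₗ[ℝ] ℝ × ℝ × ℝ} (hn : ∀ s, sqNorm (g s) = sqNorm s)
    (hg : ∀ s v, ExtentLE s v → ExtentLE (g s) v) {r : ℝ × ℝ × ℝ} {v : ℝ} (h : r ∈ pureHull v) :
    g r ∈ pureHull v := by
  have : g r ∈ g '' pureHull v := ⟨r, h, rfl⟩
  rw [pureHull, LinearMap.image_convexHull] at this
  refine convexHull_mono ?_ this
  rintro _ ⟨s, hs, rfl⟩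
  exact ⟨(hn s).trans hs.1, hg _ _ hs.2⟩

theorem sqNorm_negX (s : ℝ × ℝ × ℝ) : sqNorm (negX s) = sqNorm s := by simp [sqNorm]

theorem sqNorm_swapXY (s : ℝ × ℝ × ℝ) : sqNorm (swapXY s) = sqNorm s := by
  simp only [sqNorm, swapXY_apply]; ring

theorem sqNorm_swapXZ (s : ℝ × ℝ × ℝ) : sqNorm (swapXZ s) = sqNorm s := by
  simp only [sqNorm, swapXZ_apply]; ring

theorem swapXY_mem_pureHull {x y z v : ℝ} (h : (x, y, z) ∈ pureHull v) : (y, x, z) ∈ pureHull v :=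
  map_mem_pureHull sqNorm_swapXY (fun _ _ => ExtentLE.swapXY) h

theorem swapXZ_mem_pureHull {x y z v : ℝ} (h : (x, y, z) ∈ pureHull v) : (z, y, x) ∈ pureHull v :=
  map_mem_pureHull sqNorm_swapXZ (fun _ _ => ExtentLE.swapXZ) h

theorem swapYZ_mem_pureHull {x y z v : ℝ} (h : (x, y, z) ∈ pureHull v) : (x, z, y) ∈ pureHull v :=
  swapXY_mem_pureHull (swapXZ_mem_pureHull (swapXY_mem_pureHull h))

theorem mem_pureHull_of_segment {x y z c δ v : ℝ} (hc : x + y = 2 * c) (hδ : |x - y| ≤ 2 * δ)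
    (h₁ : (c + δ, c - δ, z) ∈ pureHull v) (h₂ : (c - δ, c + δ, z) ∈ pureHull v) :
    (x, y, z) ∈ pureHull v := by
  rw [abs_le] at hδ
  rcases (show 0 ≤ δ by linarith).eq_or_lt with rfl | h0
  · convert h₁ using 2
    · linarith
    · congr 1; linarith
  · have key := convex_pureHull v h₁ h₂
      (a := (1 + (x - y) / (2 * δ)) / 2) (b := (1 - (x - y) / (2 * δ)) / 2)
      (by have : -1 ≤ (x - y) / (2 * δ) := by rw [le_div_iff₀ (by positivity)]; linarith
          linarith)
      (by have : (x - y) / (2 * δ) ≤ 1 := by rw [div_le_iff₀ (by positivity)]; linarith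
          linarith)
      (by ring)
    convert key using 1
    obtain rfl : y = 2 * c - x := by linarith
    ext <;> simp <;> field_simp <;> ring

/-- On the sphere `4 (1 - x) (1 - y) = 2 ((x + y - 1)² + z²)`, so the bound of `extentLE_two`
depends only on `x + y` and `z`. -/
theorem extentLE_two_of_sqNorm {x y z v : ℝ} (h : x ^ 2 + y ^ 2 + z ^ 2 = 1) (hv : 2 - x - y ≤ v)
    (hb : 2 * ((x + y - 1) ^ 2 + z ^ 2) ≤ (v - 2 + x + y) ^ 2) : ExtentLE (x, y, z) v := by
  refine (extentLE_two x y z).mono ?_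
  have h1 := Real.sq_sqrt (show 0 ≤ 1 - x by nlinarith [sq_nonneg y, sq_nonneg z])
  have h2 := Real.sq_sqrt (show 0 ≤ 1 - y by nlinarith [sq_nonneg x, sq_nonneg z])
  have h3 : 2 * (√(1 - x) * √(1 - y)) ≤ v - 2 + x + y := by
    refine (le_abs_self _).trans (abs_le_of_sq_le_sq ?_ (by linarith))
    rw [mul_pow, mul_pow, h1, h2]
    linarith
  nlinarith

/-- The line through the point in direction `(1, -1, 0)` keeps `x + y` and `z`, hence the hypotheses
on `v`, and meets the sphere at two points whose segment contains the point. -/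
theorem mem_pureHull_two {x y z v : ℝ} (h : x ^ 2 + y ^ 2 + z ^ 2 ≤ 1) (hv : 2 - x - y ≤ v)
    (hb : 2 * ((x + y - 1) ^ 2 + z ^ 2) ≤ (v - 2 + x + y) ^ 2) : (x, y, z) ∈ pureHull v := by
  have hd : 0 ≤ (1 - z ^ 2) / 2 - (x + y) ^ 2 / 4 := by nlinarith [sq_nonneg (x - y)]
  set δ := √((1 - z ^ 2) / 2 - (x + y) ^ 2 / 4)
  have hδ : δ ^ 2 = _ := Real.sq_sqrt hd
  refine mem_pureHull_of_segment (c := (x + y) / 2) (δ := δ) (by ring) ?_ ?_ ?_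
  · refine abs_le_of_sq_le_sq ?_ (by positivity)
    rw [mul_pow, hδ]; linarith
  all_goals
    have e : ((x + y) / 2 + δ) ^ 2 + ((x + y) / 2 - δ) ^ 2 + z ^ 2 = 1 := by
      linear_combination 2 * hδ
  · exact mem_pureHull e (extentLE_two_of_sqNorm e (by linarith) (by ring_nf at hb ⊢; linarith))
  · have e' : ((x + y) / 2 - δ) ^ 2 + ((x + y) / 2 + δ) ^ 2 + z ^ 2 = 1 := by linarith
    exact mem_pureHull e' (extentLE_two_of_sqNorm e' (by linarith) (by ring_nf at hb ⊢; linarith))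

/-- On the common boundary of the edge and face regions the two values of `v` agree, since `2 ((2 +
√3)² + 1) = (2 + 2√3)²`. -/
theorem mem_pureHull_edge {x y e : ℝ} (he : 0 ≤ e) (h : x ^ 2 + y ^ 2 + e ^ 2 ≤ 1)
    (hs : x + y = 1 + (2 + √3) * e) : (x, y, e) ∈ pureHull (1 + √3 * e) := by
  have ht : √3 ^ 2 = 3 := Real.sq_sqrt (by norm_num)
  have ht0 : 0 ≤ √3 := Real.sqrt_nonneg 3
  refine mem_pureHull_two h ?_ ?_
  · nlinarith
  · rw [show x + y - 1 = (2 + √3) * e by linarith,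
      show 1 + √3 * e - 2 + x + y = (2 + 2 * √3) * e by linarith]
    refine le_of_eq ?_
    linear_combination (-2 * e ^ 2) * ht

theorem mem_pureHull_three {x y z e : ℝ} (he : 0 ≤ e) (hr : x ^ 2 + y ^ 2 + z ^ 2 ≤ 1)
    (h : x + y + z = 1 + (3 + √3) * e) (hx : e ≤ x) (hy : e ≤ y) (hz : e ≤ z) :
    (x, y, z) ∈ pureHull (1 + √3 * e) := by
  have hd : 0 ≤ (1 - z ^ 2) / 2 - (x + y) ^ 2 / 4 := by nlinarith [sq_nonneg (x - y)]
  set δ := √((1 - z ^ 2) / 2 - (x + y) ^ 2 / 4)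
  have hδ : δ ^ 2 = _ := Real.sq_sqrt hd
  have hxy : |x - y| ≤ 2 * δ := by
    refine abs_le_of_sq_le_sq ?_ (by positivity)
    rw [mul_pow, hδ]; linarith
  -- Moving in direction `(1, -1, 0)`, either the sphere is reached while both coordinates are still
  -- at least `e`, or one coordinate drops to `e` inside the ball, where `mem_pureHull_edge`
  -- applies.
  rcases le_total δ ((x + y) / 2 - e) with hle | hle
  · have e1 : ((x + y) / 2 + δ) ^ 2 + ((x + y) / 2 - δ) ^ 2 + z ^ 2 = 1 := by
      linear_combination 2 * hδ
    have hδ0 : 0 ≤ δ := Real.sqrt_nonneg _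
    have key : ((x + y) / 2 + δ, (x + y) / 2 - δ, z) ∈ pureHull (1 + √3 * e) :=
      mem_pureHull e1 (extentLE_three he (by linarith) (by linarith) (by linarith) hz)
    exact mem_pureHull_of_segment (by ring) hxy key (swapXY_mem_pureHull key)
  · have hn : (x + y - e) ^ 2 + z ^ 2 + e ^ 2 ≤ 1 := by
      have : ((x + y) / 2 - e) ^ 2 ≤ δ ^ 2 := pow_le_pow_left₀ (by linarith) hle 2
      rw [hδ] at this
      nlinarith
    have key := swapYZ_mem_pureHull (mem_pureHull_edge he hn (by linarith))
    refine mem_pureHull_of_segment (c := (x + y) / 2) (δ := (x + y) / 2 - e) (by ring) ?_ ?_ ?_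
    · rw [abs_le]; constructor <;> linarith
    · convert key using 2
      · ring
      · congr 1; ring
    · convert swapXY_mem_pureHull key using 2
      · ring
      · congr 1; ring

theorem mem_pureHull_octahedron {x y z : ℝ} (hx : 0 ≤ x) (hy : 0 ≤ y) (hz : 0 ≤ z)
    (h : x + y + z ≤ 1) : (x, y, z) ∈ pureHull 1 := by
  have e1 : ((1, 0, 0) : ℝ × ℝ × ℝ) ∈ pureHull 1 :=
    mem_pureHull (by simp [sqNorm]) (extentLE_one_of_abs (by simp))
  have e1' : ((-1, 0, 0) : ℝ × ℝ × ℝ) ∈ pureHull 1 :=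
    mem_pureHull (by simp [sqNorm]) (extentLE_one_of_abs (by simp))
  have e2 := swapXY_mem_pureHull e1
  have e3 := swapXZ_mem_pureHull e1
  -- The leftover weight `1 - x - y - z` is split evenly between `(1, 0, 0)` and `(-1, 0, 0)`, where
  -- it cancels.
  have := (convex_pureHull 1).sum_mem (t := Finset.univ) (w := ![x + (1 - x - y - z) / 2, (1 - x - y - z) / 2, y, z])
    (z := ![(1, 0, 0), (-1, 0, 0), (0, 1, 0), (0, 0, 1)])
    (by intro i _; fin_cases i <;> simp <;> linarith)
    (by simp [Fin.sum_univ_four]; ring)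
    (by intro i _; fin_cases i <;> simpa)
  convert this using 1
  simp [Fin.sum_univ_four]

/-- There is a witness and a mixture of pure states certifying the same value at `r`. -/
def HasCertificate (r : ℝ × ℝ × ℝ) : Prop :=
  ∃ v A w, IsBlochWitness A w ∧ A + (w.1 * r.1 + w.2.1 * r.2.1 + w.2.2 * r.2.2) = v ∧
    r ∈ pureHull v

theorem HasCertificate.negX {r : ℝ × ℝ × ℝ} (h : HasCertificate r) : HasCertificate (negX r) := by
  obtain ⟨v, A, w, hw, hv, hr⟩ := h
  refine ⟨v, A, Magic.negX w, ⟨hw.1, (sqNorm_negX w).trans_le hw.2.1, ?_⟩, ?_,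
    map_mem_pureHull sqNorm_negX (fun _ _ => ExtentLE.negX) hr⟩
  · simpa using hw.2.2
  · simpa using hv

theorem HasCertificate.swapXY {r : ℝ × ℝ × ℝ} (h : HasCertificate r) :
    HasCertificate (swapXY r) := by
  obtain ⟨v, A, w, hw, hv, hr⟩ := h
  refine ⟨v, A, Magic.swapXY w, ⟨hw.1, (sqNorm_swapXY w).trans_le hw.2.1, ?_⟩, ?_,
    map_mem_pureHull sqNorm_swapXY (fun _ _ => ExtentLE.swapXY) hr⟩
  · have := hw.2.2
    simp only [swapXY_apply]; tauto
  · simp only [swapXY_apply]; linarith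

theorem HasCertificate.swapXZ {r : ℝ × ℝ × ℝ} (h : HasCertificate r) :
    HasCertificate (swapXZ r) := by
  obtain ⟨v, A, w, hw, hv, hr⟩ := h
  refine ⟨v, A, Magic.swapXZ w, ⟨hw.1, (sqNorm_swapXZ w).trans_le hw.2.1, ?_⟩, ?_,
    map_mem_pureHull sqNorm_swapXZ (fun _ _ => ExtentLE.swapXZ) hr⟩
  · have := hw.2.2
    simp only [swapXZ_apply]; tauto
  · simp only [swapXZ_apply]; linarith

theorem hasCertificate_two {x y z : ℝ} (hr : x ^ 2 + y ^ 2 + z ^ 2 ≤ 1) (hz : 0 ≤ z)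
    (h1 : 1 < x + y) (h : (2 + √3) * z ≤ x + y - 1) : HasCertificate (x, y, z) := by
  have ht : √3 ^ 2 = 3 := Real.sq_sqrt (by norm_num)
  have ht0 : 0 ≤ √3 := Real.sqrt_nonneg 3
  have hs : √2 ^ 2 = 2 := Real.sq_sqrt (by norm_num)
  have hs0 : 0 ≤ √2 := Real.sqrt_nonneg 2
  obtain ⟨b, hb⟩ : ∃ b, b = x + y - 1 := ⟨_, rfl⟩
  rw [← hb] at h
  have hb0 : 0 < b := by linarith
  have hR : √(b ^ 2 + z ^ 2) ^ 2 = b ^ 2 + z ^ 2 := Real.sq_sqrt (by positivity)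
  have hR0 : 0 < √(b ^ 2 + z ^ 2) := Real.sqrt_pos.2 (by positivity)
  generalize √(b ^ 2 + z ^ 2) = R at hR hR0
  generalize √2 = s at hs hs0
  generalize √3 = t at ht ht0 h
  have hzb : z ≤ b := by nlinarith
  -- the optimal witness has coordinates `(m, m, n)` with `(m + 1) ^ 2 + n ^ 2 = 2`
  have hm : R ≤ s * b := by
    refine (le_abs_self _).trans (abs_le_of_sq_le_sq ?_ (by positivity))
    rw [mul_pow, hs, hR]; nlinarith
  have hbR : b ≤ R := (le_abs_self _).trans (abs_le_of_sq_le_sq (by nlinarith) hR0.le)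
  have hs2 : s ≤ 2 := by nlinarith
  have hn : R ≤ s * (b - z) := by
    refine (le_abs_self _).trans (abs_le_of_sq_le_sq ?_ (mul_nonneg hs0 (by linarith)))
    rw [mul_pow, hs, hR]
    -- The constraint `n ≤ m` squares to `b² - 4 b z + z² ≥ 0`, with roots `b = (2 ± √3) z`; this is
    -- the origin of the threshold separating the edge and face cases.
    have : 0 ≤ (b - (2 + t) * z) * (b - (2 - t) * z) :=
      mul_nonneg (by linarith) (by nlinarith)
    nlinarith
  have hun : (s * b / R) ^ 2 + (s * z / R) ^ 2 = 2 := by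
    rw [div_pow, div_pow, ← add_div, div_eq_iff (by positivity), mul_pow, mul_pow, hs, hR]; ring
  have hub : s * b / R * b + s * z / R * z = s * R := by
    field_simp; linear_combination -s * hR
  -- With `A = 1 - m` the value is `1 - b + (m + 1) b + n z`. Cauchy–Schwarz on the circle of radius
  -- `√2` makes `(m + 1, n)` parallel to `(b, z)`.
  refine ⟨1 - b + s * R, 2 - s * b / R, (s * b / R - 1, s * b / R - 1, s * z / R),
    ⟨?_, ?_, ?_, ?_, ?_⟩, ?_, mem_pureHull_two hr ?_ ?_⟩
  · rw [sub_nonneg, div_le_iff₀ hR0]; nlinarith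
  · refine le_of_eq ?_
    simp only [sqNorm]
    linear_combination hun
  · rw [abs_of_nonneg (by rw [sub_nonneg, le_div_iff₀ hR0]; linarith)]; linarith
  · rw [abs_of_nonneg (by rw [sub_nonneg, le_div_iff₀ hR0]; linarith)]; linarith
  · rw [abs_of_nonneg (by positivity)]
    have : 1 ≤ s * (b - z) / R := by rw [le_div_iff₀ hR0]; linarith
    have e : s * (b - z) / R = s * b / R - s * z / R := by ring
    linarith
  · linear_combination hub - (s * b / R - 1) * hb
  · nlinarith
  · rw [← hb]
    refine le_of_eq ?_
    rw [show 1 - b + s * R - 2 + x + y = s * R by linarith, mul_pow, hs, hR]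

/-- The witness is proportional to the projector onto the ket with Bloch vector `(1, 1, 1) / √3`:
`A² = |w|²` and all three constraints `A + |w_i| ≤ 1` are tight. -/
theorem hasCertificate_three {x y z e : ℝ} (he : 0 ≤ e) (hr : x ^ 2 + y ^ 2 + z ^ 2 ≤ 1)
    (h : x + y + z = 1 + (3 + √3) * e) (hx : e ≤ x) (hy : e ≤ y) (hz : e ≤ z) :
    HasCertificate (x, y, z) := by
  have key := mem_pureHull_three he hr h hx hy hz
  have ht : √3 ^ 2 = 3 := Real.sq_sqrt (by norm_num)
  have ht0 : 0 ≤ √3 := Real.sqrt_nonneg 3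
  generalize √3 = t at *
  have hm : 0 ≤ 1 / (1 + t) := by positivity
  refine ⟨_, t / (1 + t), (1 / (1 + t), 1 / (1 + t), 1 / (1 + t)),
    ⟨by positivity, ?_, ?_, ?_, ?_⟩, ?_, key⟩
  · refine le_of_eq ?_
    simp only [sqNorm, div_pow]
    rw [ht]; ring
  iterate 3
    · rw [abs_of_nonneg hm, ← add_div, add_comm, div_self (by positivity)]
  · field_simp
    linear_combination h - e * ht

theorem hasCertificate_of_sorted {x y z : ℝ} (hr : sqNorm (x, y, z) ≤ 1) (hz : 0 ≤ z)
    (hyz : z ≤ y) (hxy : y ≤ x) : HasCertificate (x, y, z) := by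
  simp only [sqNorm] at hr
  have ht0 : 0 ≤ √3 := Real.sqrt_nonneg 3
  rcases le_or_gt (x + y + z) 1 with h1 | h1
  · exact ⟨1, 1, 0, by simp [IsBlochWitness, sqNorm], by simp,
      mem_pureHull_octahedron (by linarith) (by linarith) hz h1⟩
  -- With `e = (x + y + z - 1) / (3 + √3)`, the second alternative says exactly `e ≤ z`, the
  -- smallest coordinate.
  · rcases le_total ((2 + √3) * z) (x + y - 1) with h | h
    · refine hasCertificate_two hr hz ?_ h
      nlinarith
    · have hle : (x + y + z - 1) / (3 + √3) ≤ z := by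
        rw [div_le_iff₀ (by positivity)]; linarith
      exact hasCertificate_three (e := (x + y + z - 1) / (3 + √3))
        (div_nonneg (by linarith) (by positivity)) hr (by field_simp; ring)
        (by linarith) (by linarith) hle

theorem hasCertificate {r : ℝ × ℝ × ℝ} (hr : sqNorm r ≤ 1) : HasCertificate r := by
  have invXY : ∀ {r}, HasCertificate (swapXY r) → HasCertificate r := fun h => by
    simpa using h.swapXY
  have invXZ : ∀ {r}, HasCertificate (swapXZ r) → HasCertificate r := fun h => by
    simpa using h.swapXZ
  have invX : ∀ {r}, HasCertificate (negX r) → HasCertificate r := fun h => by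
    simpa using h.negX
  have nonneg : ∀ x y z : ℝ, sqNorm (x, y, z) ≤ 1 → 0 ≤ x → 0 ≤ y → 0 ≤ z →
      HasCertificate (x, y, z) := by
    have yz : ∀ x y z : ℝ, sqNorm (x, y, z) ≤ 1 → 0 ≤ x → 0 ≤ y → 0 ≤ z → z ≤ y → z ≤ x →
        HasCertificate (x, y, z) := by
      intro x y z h hx hy hz hzy hzx
      rcases le_total y x with hyx | hyx
      · exact hasCertificate_of_sorted h hz hzy hyx
      · exact invXY (hasCertificate_of_sorted ((sqNorm_swapXY _).trans_le h) hz hzx hyx)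
    intro x y z h hx hy hz
    rcases le_total z x with hzx | hzx
    · rcases le_total z y with hzy | hzy
      · exact yz x y z h hx hy hz hzy hzx
      · exact invXY (invXZ (yz z x y (by simp only [sqNorm] at h ⊢; linarith) hz hx hy
          (by linarith) (by linarith)))
    · rcases le_total x y with hxy | hxy
      · exact invXZ (yz z y x (by simp only [sqNorm] at h ⊢; linarith) hz hy hx hxy hzx)
      · exact invXY (invXZ (yz z x y (by simp only [sqNorm] at h ⊢; linarith) hz hx hy
          (by linarith) (by linarith)))
  have absX : ∀ x y z : ℝ, HasCertificate (|x|, y, z) → HasCertificate (x, y, z) := by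
    intro x y z h
    rcases abs_choice x with e | e <;> rw [e] at h
    · exact h
    · exact invX h
  obtain ⟨x, y, z⟩ := r
  refine absX _ _ _ (invXY (absX _ _ _ (invXZ (absX _ _ _ ?_))))
  refine nonneg _ _ _ ?_ (abs_nonneg _) (abs_nonneg _) (abs_nonneg _)
  simp only [sqNorm, sq_abs] at hr ⊢
  linarith

end Geometry

/-! ### From certificates to attained optima. -/

section Main

/-- A unit vector is an extreme point of the ball, so it lies in the hull only if it is one of the
generators; otherwise every generator `s` satisfies `r·s < 1`, and hence so would `r` itself. -/
theorem extentLE_of_mem_pureHull {r : ℝ × ℝ × ℝ} {v : ℝ} (hr : sqNorm r = 1)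
    (h : r ∈ pureHull v) : ExtentLE r v := by
  by_contra hn
  have hlin : IsLinearMap ℝ fun s : ℝ × ℝ × ℝ => r.1 * s.1 + r.2.1 * s.2.1 + r.2.2 * s.2.2 :=
    ⟨fun s t => by simp; ring, fun a s => by simp; ring⟩
  have hsub : pureHull v ⊆ {s | r.1 * s.1 + r.2.1 * s.2.1 + r.2.2 * s.2.2 < 1} := by
    refine convexHull_min ?_ (convex_halfSpace_lt hlin 1)
    rintro s ⟨hs, hv⟩
    by_contra! hge
    simp only [Set.mem_ofPred_eq, not_lt, sqNorm] at hge hs hr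
    have hsum : (r.1 - s.1) ^ 2 + (r.2.1 - s.2.1) ^ 2 + (r.2.2 - s.2.2) ^ 2 ≤ 0 := by linarith
    have h1 : r.1 = s.1 := by
      nlinarith [sq_nonneg (r.1 - s.1), sq_nonneg (r.2.1 - s.2.1), sq_nonneg (r.2.2 - s.2.2)]
    have h2 : r.2.1 = s.2.1 := by
      nlinarith [sq_nonneg (r.1 - s.1), sq_nonneg (r.2.1 - s.2.1), sq_nonneg (r.2.2 - s.2.2)]
    have h3 : r.2.2 = s.2.2 := by
      nlinarith [sq_nonneg (r.1 - s.1), sq_nonneg (r.2.1 - s.2.1), sq_nonneg (r.2.2 - s.2.2)]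
    obtain rfl : r = s := Prod.ext h1 (Prod.ext h2 h3)
    exact hn hv
  have := hsub h
  simp only [Set.mem_ofPred_eq, sqNorm] at this hr
  linarith

/-- The certificate at a unit Bloch vector gives both an attained decomposition and, through weak
duality for `|ψ⟩⟨ψ|`, its optimality; no compactness is needed. -/
theorem isLeast_extentValues {ψ : Fin 2 → ℂ} (hψ : IsKet ψ) :
    IsLeast (extentValues stabilizerKets ψ) (extent stabilizerKets ψ) := by
  obtain ⟨v, A, w, hw, hv, hr⟩ := hasCertificate hψ.sqNorm_bloch.le
  obtain ⟨y, hy, hyv⟩ := extentLE_of_mem_pureHull hψ.sqNorm_bloch hr ψ hψ rfl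
  have hleast : IsLeast (extentValues stabilizerKets ψ) y := by
    refine ⟨hy, fun x hx => hyv.trans ?_⟩
    have := re_trace_le_of_mem_dyadicValues hw.mem_witnesses
      (extentValues_subset_dyadicValues hψ hx)
    rw [dyad_self_eq hψ, re_trace_pauliComb_mul] at this
    simp only [Prod.smul_fst, Prod.smul_snd, smul_eq_mul] at this
    linarith
  rwa [extent, hleast.csInf_eq]

theorem ExtentLE.extent_le {ψ : Fin 2 → ℂ} {s : ℝ × ℝ × ℝ} {v : ℝ} (h : ExtentLE s v)
    (hψ : IsKet ψ) (hs : bloch ψ = s) : extent stabilizerKets ψ ≤ v :=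
  let ⟨_, hy, hyv⟩ := h ψ hψ hs
  ((isLeast_extentValues hψ).2 hy).trans hyv

theorem exists_isPureDecomposition_of_mem_pureHull {r : ℝ × ℝ × ℝ} {v : ℝ}
    (h : r ∈ pureHull v) : ∃ (k : ℕ) (p : Fin k → ℝ) (Ψ : Fin k → Fin 2 → ℂ),
      IsPureDecomposition (pauliComb (1 / 2) ((1 / 2 : ℝ) • r)) p Ψ ∧ (∀ j, 0 < p j) ∧
        ∀ j, extent stabilizerKets (Ψ j) ≤ v := by
  -- Carathéodory in the form with strictly positive weights, which equimagicality requires.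
  obtain ⟨ι, _, s, p, hs, -, hp, hp1, rfl⟩ := eq_pos_convex_span_of_mem_convexHull h
  have hs : ∀ i, sqNorm (s i) = 1 ∧ ExtentLE (s i) v := fun i => hs ⟨i, rfl⟩
  choose Ψ hΨ hb using fun i => exists_ket_bloch_eq (hs i).1
  let e := (Fintype.equivFin ι).symm
  refine ⟨_, p ∘ e, Ψ ∘ e, ⟨fun j => (hp _).le, (e.sum_comp p).trans hp1, fun j => hΨ _, ?_⟩,
    fun j => hp _, fun j => (hs (e j)).2.extent_le (hΨ _) (hb _)⟩
  rw [pauliComb_sum p s hp1]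
  refine Eq.trans ?_ (e.sum_comp fun i => (p i : ℂ) • dyad (Ψ i) (Ψ i)).symm
  exact Finset.sum_congr rfl fun i _ => by rw [dyad_self_eq (hΨ i), hb]

theorem mixedExtentValues_subset_dyadicValues (ρ : Matrix (Fin 2) (Fin 2) ℂ) :
    mixedExtentValues stabilizerKets ρ ⊆ dyadicValues stabilizerKets ρ := by
  rintro _ ⟨k, p, Ψ, h, rfl⟩
  exact sum_mul_mem_dyadicValues h fun j => (isLeast_extentValues (h.2.2.1 j)).1

end Main

end Magic

theorem mainTheorem2 :
    -- the minimum defining the extent of a pure single-qubit state exists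
    (∀ ψ : Fin 2 → ℂ, Magic.IsKet ψ →
      IsLeast (Magic.extentValues Magic.stabilizerKets ψ)
        (Magic.extent Magic.stabilizerKets ψ)) ∧
    ∀ ρ : Matrix (Fin 2) (Fin 2) ℂ, Magic.IsState ρ →
      -- the maximum and the minima defining the three monotones exist
      IsGreatest (Magic.robustnessValues Magic.stabilizerKets ρ)
        (Magic.generalizedRobustness Magic.stabilizerKets ρ) ∧
      IsLeast (Magic.dyadicValues Magic.stabilizerKets ρ)
        (Magic.dyadicNegativity Magic.stabilizerKets ρ) ∧
      IsLeast (Magic.mixedExtentValues Magic.stabilizerKets ρ)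
        (Magic.mixedExtent Magic.stabilizerKets ρ) ∧
      -- the three monotones coincide
      Magic.generalizedRobustness Magic.stabilizerKets ρ
        = Magic.dyadicNegativity Magic.stabilizerKets ρ ∧
      Magic.dyadicNegativity Magic.stabilizerKets ρ
        = Magic.mixedExtent Magic.stabilizerKets ρ ∧
      -- there is an equimagical decomposition
      Magic.IsEquimagical Magic.stabilizerKets ρ := by
  refine ⟨fun ψ hψ => Magic.isLeast_extentValues hψ, fun ρ hρ => ?_⟩
  obtain ⟨r, hr, hρr⟩ := hρ.exists_eq_pauliComb
  obtain ⟨v, A, w, hw, hv, hrv⟩ := Magic.hasCertificate hr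
  obtain ⟨k, p, Ψ, hdec, hp, hext⟩ := Magic.exists_isPureDecomposition_of_mem_pureHull hrv
  rw [← hρr] at hdec
  have hvr : v ∈ Magic.robustnessValues Magic.stabilizerKets ρ := by
    refine ⟨_, hw.mem_witnesses, Magic.posSemidef_pauliComb hw.1 hw.2.1, ?_⟩
    rw [hρr, Magic.re_trace_pauliComb_mul]
    simp only [Prod.smul_fst, Prod.smul_snd, smul_eq_mul]
    linarith
  have weak : ∀ x ∈ Magic.robustnessValues Magic.stabilizerKets ρ,
      ∀ y ∈ Magic.dyadicValues Magic.stabilizerKets ρ, x ≤ y := by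
    rintro _ ⟨W, hW, -, rfl⟩ y hy
    exact Magic.re_trace_le_of_mem_dyadicValues hW hy
  have hmem : ∑ j, p j * Magic.extent Magic.stabilizerKets (Ψ j)
      ∈ Magic.mixedExtentValues Magic.stabilizerKets ρ := ⟨k, p, Ψ, hdec, rfl⟩
  have hsub := Magic.mixedExtentValues_subset_dyadicValues ρ
  have hterm : ∀ j ∈ Finset.univ, p j * Magic.extent Magic.stabilizerKets (Ψ j) ≤ p j * v :=
    fun j _ => mul_le_mul_of_nonneg_left (hext j) (hp j).le
  have hpv : ∑ j, p j * v = v := by rw [← Finset.sum_mul, hdec.2.1, one_mul]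
  have hsum : ∑ j, p j * Magic.extent Magic.stabilizerKets (Ψ j) = v :=
    le_antisymm ((Finset.sum_le_sum hterm).trans_eq hpv) (weak _ hvr _ (hsub hmem))
  -- Extents at most `v` with average `v` and positive weights must all equal `v`.
  have hconst : ∀ j, Magic.extent Magic.stabilizerKets (Ψ j) = v := fun j =>
    mul_left_cancel₀ (hp j).ne'
      ((Finset.sum_eq_sum_iff_of_le hterm).1 (hsum.trans hpv.symm) j (Finset.mem_univ j))
  rw [hsum] at hmem
  have hG : IsGreatest (Magic.robustnessValues Magic.stabilizerKets ρ) v :=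
    ⟨hvr, fun x hx => weak x hx v (hsub hmem)⟩
  have hD : IsLeast (Magic.dyadicValues Magic.stabilizerKets ρ) v :=
    ⟨hsub hmem, fun y hy => weak v hvr y hy⟩
  have hM : IsLeast (Magic.mixedExtentValues Magic.stabilizerKets ρ) v :=
    ⟨hmem, fun y hy => hD.2 (hsub hy)⟩
  have eG : Magic.generalizedRobustness Magic.stabilizerKets ρ = v := hG.csSup_eq
  have eD : Magic.dyadicNegativity Magic.stabilizerKets ρ = v := hD.csInf_eq
  have eM : Magic.mixedExtent Magic.stabilizerKets ρ = v := hM.csInf_eq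
  rw [eG, eD, eM]
  exact ⟨hG, hD, hM, rfl, rfl, k, p, Ψ, hdec, hsum.symm ▸ hM,
    fun i j => (hconst i).trans (hconst j).symm⟩
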